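/- All graphs are finite and simple. A \emph{detour} of a graph is a longest path in it, and a graph is \emph{detour covered} if every one of its vertices lies in a detour. Let $\delta(G)$ denote the minimum degree of $G$. \textbf{Theorem 5.} If $G$ is a connected graph of order $n$ with $\delta(G)\ge (n-2)/3$, then $G$ is detour covered. The bound is best possible: for every integer $n\ge 6$ there exists a connected graph $R_n$ of order $n$ with $\delta(R_n)=\lceil (n-2)/3\rceil-1$ which is not detour covered. -/

import Mathlib

namespace SimpleGraph

/-- A walk is a *detour* of `G` if it is a longest path of `G`: it is a path, and no path of `G`
(between any two vertices) is longer. -/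
def Walk.IsDetour {V : Type*} {G : SimpleGraph V} {u v : V} (p : G.Walk u v) : Prop :=
  p.IsPath ∧ ∀ (x y : V) (q : G.Walk x y), q.IsPath → q.length ≤ p.length

/-- A graph is *detour covered* if every vertex lies in a detour. -/
def IsDetourCovered {V : Type*} (G : SimpleGraph V) : Prop :=
  ∀ w : V, ∃ (u v : V) (p : G.Walk u v), p.IsDetour ∧ w ∈ p.support

end SimpleGraph

/-! Let `P` be a longest path, on p vertices, and suppose that no longest path contains `w`. Among
the paths through `w` that avoid `P`, take a longest one `Q`, on t vertices. Every neighbour of an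
end of `Q` lies on `P` or `Q`, so each end has at least δ + 1 - t neighbours on `P`. Rerouting `P`
through `Q` gives a path containing `w`, hence a strictly shorter one; this keeps attachments far
from the ends of `P` and separates those of opposite ends of `Q`. Counting positions along `P` gives
p + t > 3δ + 2 (`not_isPathList_max_of_uncovered`). If neither end of `Q` has a neighbour on `P`,
then `Q` contains a cycle on more than δ vertices, and a path from `P` around that cycle makes `P`
too long.

Sharpness: in three cliques joined to a cut vertex, a path meets at most two cliques, so the longest
paths avoid the smallest one. -/

namespace SimpleGraph

/-! ### Paths as vertex lists, and rerouting -/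

/-- A list of vertices is a *path list* of `G` if it is the support of a path, or empty. -/
def IsPathList {V : Type*} (G : SimpleGraph V) (l : List V) : Prop :=
  l.IsChain G.Adj ∧ l.Nodup

namespace IsPathList

variable {V : Type*} {G : SimpleGraph V} {l l₁ l₂ : List V}

theorem singleton (v : V) : G.IsPathList [v] := ⟨.singleton v, List.nodup_singleton v⟩

theorem append (h₁ : G.IsPathList l₁) (h₂ : G.IsPathList l₂) (hd : l₁.Disjoint l₂)
    (h : ∀ x ∈ l₁.getLast?, ∀ y ∈ l₂.head?, G.Adj x y) : G.IsPathList (l₁ ++ l₂) :=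
  ⟨h₁.1.append h₂.1 h, h₁.2.append h₂.2 hd⟩

theorem reverse (h : G.IsPathList l) : G.IsPathList l.reverse :=
  ⟨List.isChain_reverse.2 (h.1.imp fun _ _ hab => hab.symm), List.nodup_reverse.2 h.2⟩

theorem of_isInfix (h : G.IsPathList l) (hl : l₁ <:+: l) : G.IsPathList l₁ :=
  ⟨h.1.infix hl, h.2.sublist hl.sublist⟩

theorem take (h : G.IsPathList l) (i : ℕ) : G.IsPathList (l.take i) :=
  h.of_isInfix (List.take_prefix i l).isInfix

theorem drop (h : G.IsPathList l) (i : ℕ) : G.IsPathList (l.drop i) :=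
  h.of_isInfix (List.drop_suffix i l).isInfix

theorem length_le_card [Fintype V] (h : G.IsPathList l) : l.length ≤ Fintype.card V :=
  h.2.length_le_card

theorem exists_walk (h : G.IsPathList l) (hl : l ≠ []) :
    ∃ (u v : V) (p : G.Walk u v), p.IsPath ∧ p.support = l :=
  ⟨_, _, Walk.ofSupport l hl h.1, by
    rw [Walk.isPath_def, Walk.support_ofSupport]; exact h.2, Walk.support_ofSupport hl h.1⟩

theorem of_isPath {u v : V} {p : G.Walk u v} (hp : p.IsPath) : G.IsPathList p.support :=
  ⟨p.isChain_adj_support, hp.support_nodup⟩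

end IsPathList

/-- A path that leaves `P` at position `i` and continues outside `P`, keeping the initial part. -/
theorem IsPathList.take_append {V : Type*} {G : SimpleGraph V} {P R : List V}
    (hP : G.IsPathList P) (hR : G.IsPathList R) (hd : P.Disjoint R) {i : ℕ} (hi : i < P.length)
    (h : ∀ y ∈ R.head?, G.Adj P[i] y) : G.IsPathList (P.take (i + 1) ++ R) := by
  refine (hP.take _).append hR (fun x hx => hd (List.mem_of_mem_take hx)) ?_
  intro x hx y hy
  have : P[i] = x := by
    simpa [List.getLast?_take, hi] using hx
  exact this ▸ h y hy

/-- A path that starts outside `P`, enters `P` at position `j` and follows the final part. -/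
theorem IsPathList.append_drop {V : Type*} {G : SimpleGraph V} {P R : List V}
    (hP : G.IsPathList P) (hR : G.IsPathList R) (hd : P.Disjoint R) {j : ℕ} (hj : j < P.length)
    (h : ∀ y ∈ R.getLast?, G.Adj P[j] y) : G.IsPathList (R ++ P.drop j) := by
  refine hR.append (hP.drop _) (fun x hx hx' => hd (List.mem_of_mem_drop hx') hx) ?_
  intro x hx y hy
  have : P[j] = y := by
    simpa [List.head?_drop, hj] using hy
  exact this ▸ (h x hx).symm

/-- A detour of `P` through `R` between positions `i < j`. -/
theorem IsPathList.take_append_drop {V : Type*} {G : SimpleGraph V} {P R : List V}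
    (hP : G.IsPathList P) (hR : G.IsPathList R) (hd : P.Disjoint R) (hne : R ≠ [])
    {i j : ℕ} (hij : i < j)
    (hj : j < P.length) (h : ∀ y ∈ R.head?, G.Adj (P[i]'(hij.trans hj)) y)
    (h' : ∀ y ∈ R.getLast?, G.Adj P[j] y) :
    G.IsPathList (P.take (i + 1) ++ (R ++ P.drop j)) := by
  refine (hP.take _).append (hP.append_drop hR hd hj h') ?_ ?_
  · intro x hx hx'
    rcases List.mem_append.1 hx' with hx' | hx'
    · exact hd (List.mem_of_mem_take hx) hx'
    · exact List.disjoint_take_drop hP.2 hij hx hx'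
  · intro x hx y hy
    have : P[i]'(hij.trans hj) = x := by
      simpa [List.getLast?_take, hij.trans hj] using hx
    rw [List.head?_append_of_ne_nil _ hne] at hy
    exact this ▸ h y hy

end SimpleGraph

/-! ### Splitting lists and packing intervals -/

theorem List.exists_eq_append_first {α : Type*} (p : α → Prop) :
    ∀ l : List α, (∃ x ∈ l, p x) → ∃ l₁ x l₂, l = l₁ ++ x :: l₂ ∧ p x ∧ ∀ y ∈ l₁, ¬ p y
  | [], h => by simp at h
  | a :: l, h => by
    by_cases ha : p a
    · exact ⟨[], a, l, rfl, ha, by simp⟩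
    · obtain ⟨l₁, x, l₂, h₁, h₂, h₃⟩ := exists_eq_append_first p l (by simpa [ha] using h)
      exact ⟨a :: l₁, x, l₂, by simp [h₁], h₂, by simpa [ha] using h₃⟩

theorem List.exists_eq_append_last {α : Type*} (p : α → Prop) (l : List α) (h : ∃ x ∈ l, p x) :
    ∃ l₁ x l₂, l = l₁ ++ x :: l₂ ∧ p x ∧ ∀ y ∈ l₂, ¬ p y := by
  obtain ⟨l₁, x, l₂, h₁, h₂, h₃⟩ := exists_eq_append_first p l.reverse (by simpa using h)
  exact ⟨l₂.reverse, x, l₁.reverse, by simpa using congrArg List.reverse h₁, h₂, by simpa using h₃⟩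

/-- Disjoint intervals `[i, i + f i)` inside `[m, p)` have total length at most `p - m`. -/
theorem Finset.add_sum_le_of_separated (N : Finset ℕ) (f : ℕ → ℕ) {m p : ℕ} (hmp : m ≤ p)
    (hm : ∀ i ∈ N, m ≤ i) (hp : ∀ i ∈ N, i + f i ≤ p)
    (hN : ∀ i ∈ N, ∀ j ∈ N, i < j → i + f i ≤ j) : m + ∑ i ∈ N, f i ≤ p := by
  have hd : (N : Set ℕ).PairwiseDisjoint fun i => Finset.Ico i (i + f i) := by
    intro i hi j hj hij
    refine Finset.disjoint_left.2 fun x hx hx' => ?_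
    simp only [Finset.mem_Ico] at hx hx'
    rcases lt_or_gt_of_ne hij with h | h
    · have := hN i hi j hj h
      omega
    · have := hN j hj i hi h
      omega
  have h1 : (N.biUnion fun i => Finset.Ico i (i + f i)) ⊆ Finset.Ico m p := by
    intro x hx
    simp only [Finset.mem_biUnion, Finset.mem_Ico] at hx ⊢
    obtain ⟨i, hi, h⟩ := hx
    have := hm i hi
    have := hp i hi
    omega
  have h2 := Finset.card_le_card h1
  rw [Finset.card_biUnion hd] at h2
  simp at h2
  omega

namespace SimpleGraph

variable {V : Type*} {G : SimpleGraph V}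

/-! ### Paths attached to a longest path -/

/-- If `C` is a cycle outside `P`, then in a connected graph some path outside `P` that is
attached to `P` runs through all of `C`. -/
theorem exists_isPathList_attached_of_cycle (hG : G.Connected) {P C : List V} (hP : P ≠ [])
    (hC : G.IsPathList C) (hne : C ≠ []) (hd : P.Disjoint C)
    (hcyc : G.Adj (C.getLast hne) (C.head hne)) :
    ∃ R, G.IsPathList R ∧ R ≠ [] ∧ P.Disjoint R ∧ C.length ≤ R.length ∧
      ∃ (i : ℕ) (hi : i < P.length), ∀ y ∈ R.head?, G.Adj P[i] y := by
  classical
  obtain ⟨p, hp⟩ := (hG.preconnected (P.head hP) (C.head hne)).exists_isPath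
  have hL := IsPathList.of_isPath hp
  have hlast : p.support.getLast? = some (C.head hne) := by
    rw [List.getLast?_eq_getLast_of_ne_nil p.support_ne_nil, Walk.getLast_support]
  -- Between its last vertex on `P` and the next vertex on `C`, the connecting path avoids both.
  obtain ⟨L₁, x, L₂, h₁, hx, hL₂⟩ := List.exists_eq_append_last (· ∈ P) p.support
    ⟨_, p.start_mem_support, List.head_mem hP⟩
  rw [h₁] at hL hlast
  have hmem : C.head hne ∈ L₂ := by
    rcases L₂.eq_nil_or_concat with rfl | ⟨L, b, rfl⟩
    · have : x = C.head hne := by simpa using hlast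
      exact absurd (List.head_mem hne) (hd (this ▸ hx))
    · have : b = C.head hne := by
        rw [List.concat_eq_append, ← List.cons_append, ← List.append_assoc,
          List.getLast?_concat] at hlast
        exact Option.some.inj hlast
      simp [this]
  obtain ⟨L₃, c, L₄, h₂, hc, hL₃⟩ := List.exists_eq_append_first (· ∈ C) L₂
    ⟨_, hmem, List.head_mem hne⟩
  obtain ⟨A, B, h₃⟩ := List.append_of_mem hc
  subst h₃ h₂
  -- The cycle is opened at the entry vertex `c`, so that it is traversed completely.
  have hrot : G.IsPathList (c :: B ++ A) := by
    refine IsPathList.append (hC.of_isInfix (List.suffix_append _ _).isInfix)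
      (hC.of_isInfix (List.prefix_append _ _).isInfix) (List.disjoint_of_nodup_append hC.2).symm ?_
    intro a ha b hb
    rcases A with _ | ⟨a', A⟩
    · simp at hb
    · have : b = a' := by simpa using hb.symm
      subst this
      rw [List.getLast?_eq_getLast_of_ne_nil (List.cons_ne_nil _ _)] at ha
      have : (c :: B).getLast (by simp) = a := by simpa using ha
      subst this
      simpa using hcyc
  have hx3 : G.IsPathList (x :: (L₃ ++ [c])) :=
    hL.of_isInfix ⟨L₁, L₄, by simp⟩
  refine ⟨L₃ ++ (c :: B ++ A), ?_, by simp, ?_, by simp; omega, ?_⟩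
  · refine IsPathList.append (hx3.of_isInfix ⟨[x], [c], by simp⟩) hrot ?_ ?_
    · intro y hy hy'
      exact hL₃ y hy (by simp at hy' ⊢; tauto)
    · have := hx3.1.tail
      simp only [List.tail_cons] at this
      rw [List.isChain_append] at this
      intro a ha b hb
      exact this.2.2 a ha b (by simpa using hb)
  · intro y hy hy'
    rcases List.mem_append.1 hy' with hy' | hy'
    · exact hL₂ y (by simp [hy']) hy
    · exact hd hy (by simp at hy' ⊢; tauto)
  · obtain ⟨i, hi, rfl⟩ := List.getElem_of_mem hx
    refine ⟨i, hi, fun y hy => ?_⟩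
    have := hx3.1
    rw [List.isChain_cons] at this
    exact this.1 y (by rcases L₃ with _ | ⟨a, L₃⟩ <;> simpa using hy)

theorem exists_longest_isPathList [Fintype V] (p : List V → Prop)
    (h : ∃ L, G.IsPathList L ∧ p L) :
    ∃ L, (G.IsPathList L ∧ p L) ∧ ∀ L', G.IsPathList L' → p L' → L'.length ≤ L.length := by
  classical
  obtain ⟨L₀, h₀, hp₀⟩ := h
  let s : ℕ → Prop := fun k => ∃ L, G.IsPathList L ∧ p L ∧ L.length = k
  have hs : s (Nat.findGreatest s (Fintype.card V)) :=
    Nat.findGreatest_spec h₀.length_le_card ⟨L₀, h₀, hp₀, rfl⟩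
  obtain ⟨L, hL, hpL, hlen⟩ := hs
  exact ⟨L, ⟨hL, hpL⟩, fun L' hL' hp' => hlen ▸
    Nat.le_findGreatest hL'.length_le_card ⟨L', hL', hp', rfl⟩⟩

open Classical in
/-- The positions of `P` that carry a neighbour of `u`. -/
noncomputable def attachments (G : SimpleGraph V) (P : List V) (u : V) : Finset ℕ :=
  (Finset.range P.length).filter fun i => ∃ h : i < P.length, G.Adj P[i] u

theorem mem_attachments {P : List V} {u : V} {i : ℕ} :
    i ∈ G.attachments P u ↔ ∃ h : i < P.length, G.Adj P[i] u := by
  simp only [attachments, Finset.mem_filter, Finset.mem_range, and_iff_right_iff_imp]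
  exact fun h => h.1

theorem minDegree_lt_card_attachments_add [Fintype V] [DecidableRel G.Adj] {P Q : List V} {u : V}
    (hQ : Q.Nodup) (hu : u ∈ Q) (h : ∀ y, G.Adj u y → y ∈ P ∨ y ∈ Q) :
    G.minDegree + 1 ≤ (G.attachments P u).card + Q.length := by
  classical
  have hsub : G.neighborFinset u ⊆
      (G.attachments P u).image (fun i => P.getD i u) ∪ Q.toFinset.erase u := by
    intro y hy
    rw [mem_neighborFinset] at hy
    rw [Finset.mem_union]
    rcases h y hy with h | h
    · left
      obtain ⟨i, hi, rfl⟩ := List.getElem_of_mem h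
      exact Finset.mem_image.2 ⟨i, mem_attachments.2 ⟨hi, hy.symm⟩, by simp [hi]⟩
    · right
      simp [h, hy.ne']
  have h1 := (Finset.card_le_card hsub).trans (Finset.card_union_le _ _)
  have h2 := Finset.card_image_le (s := G.attachments P u) (f := fun i => P.getD i u)
  rw [Finset.card_erase_of_mem (by simpa using hu), List.toFinset_card_of_nodup hQ,
    card_neighborFinset_eq_degree] at h1
  have h3 := G.minDegree_le_degree u
  have := List.length_pos_of_mem hu
  omega

/-- A path outside `P` attached to `P` at position `i` is at most as long as either part of `P`. -/
theorem length_bounds_of_attached {P R : List V} {i e : ℕ}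
    (hP : G.IsPathList P) (hR : G.IsPathList R) (hd : P.Disjoint R) (hi : i < P.length)
    (h : ∀ y ∈ R.head?, G.Adj P[i] y)
    (hmax : ∀ L, G.IsPathList L → R ⊆ L → L.length + e ≤ P.length) :
    R.length + e ≤ i ∧ i + 1 + R.length + e ≤ P.length := by
  constructor
  · have := hmax _ (hP.append_drop hR.reverse (by simpa using hd) hi (by simpa using h)) (by simp)
    simp at this
    omega
  · have := hmax _ (hP.take_append hR hd hi h) (by simp)
    simp at this
    omega

/-- Replacing the stretch of `P` between the two attachments by `R` cannot give too long a path. The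
slack `e` is 1 when `R` contains the uncovered vertex and 0 otherwise. -/
theorem gap_of_attached {P R : List V} {i j e : ℕ}
    (hP : G.IsPathList P) (hR : G.IsPathList R) (hd : P.Disjoint R) (hne : R ≠ [])
    (hij : i < j) (hi : i ∈ G.attachments P (R.head hne))
    (hj : j ∈ G.attachments P (R.getLast hne))
    (hmax : ∀ L, G.IsPathList L → R ⊆ L → L.length + e ≤ P.length) :
    i + 1 + R.length + e ≤ j := by
  obtain ⟨hi', hi⟩ := mem_attachments.1 hi
  obtain ⟨hj', hj⟩ := mem_attachments.1 hj
  have := hmax _ (hP.take_append_drop hR hd hne hij hj'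
    (by simpa [List.head?_eq_some_head hne] using hi)
    (by simpa [List.getLast?_eq_getLast_of_ne_nil hne] using hj))
    (fun x hx => by simp [hx])
  simp at this
  omega

/-- This is (c - 1)(t - 2) ≥ 0. -/
theorem mul_add_le_of_one_le {c t : ℕ} (hc : 1 ≤ c) (ht : 2 ≤ t) : t + 2 * c ≤ c * t + 2 := by
  obtain ⟨a, rfl⟩ := Nat.exists_eq_add_of_le ht
  obtain ⟨b, rfl⟩ := Nat.exists_eq_add_of_le hc
  ring_nf
  omega

theorem not_isPathList_max_of_uncovered [Fintype V] [DecidableRel G.Adj] (hG : G.Connected)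
    (hδ : Fintype.card V ≤ 3 * G.minDegree + 2) {P : List V} {w : V} (hP : G.IsPathList P)
    (hmax : ∀ L, G.IsPathList L → L.length ≤ P.length)
    (hw : ∀ L, G.IsPathList L → w ∈ L → L.length < P.length) : False := by
  classical
  have hwP : w ∉ P := fun h => (hw P hP h).false
  have hp1 : 1 < P.length := hw [w] (.singleton w) (by simp)
  obtain ⟨Q, ⟨hQ, hwQ, hd⟩, hQmax⟩ :=
    exists_longest_isPathList (G := G) (fun L => w ∈ L ∧ P.Disjoint L)
      ⟨[w], .singleton w, by simp, by simpa using hwP⟩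
  have hne : Q ≠ [] := List.ne_nil_of_mem hwQ
  have hne' : Q.reverse ≠ [] := by simpa using hne
  have hdr : P.Disjoint Q.reverse := by simpa using hd
  have ht : 1 ≤ Q.length := List.length_pos_of_mem hwQ
  have hcard : P.length + Q.length ≤ Fintype.card V := by
    simpa using (hP.2.append hQ.2 hd).length_le_card
  set δ := G.minDegree with hδdef
  -- Stated for all such `R` so that it serves both `Q` and its reversal, hence both ends.
  have hnbr : ∀ R (hR : R ≠ []), G.IsPathList R → w ∈ R → P.Disjoint R → R.length = Q.length →
      ∀ y, G.Adj (R.head hR) y → y ∈ P ∨ y ∈ R := by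
    intro R hR hRp hwR hdR hlen y hy
    by_contra! hcon
    have := hQmax (y :: R)
      (IsPathList.append (.singleton y) hRp (by simpa using hcon.2)
        (by simpa [List.head?_eq_some_head hR] using hy.symm))
      ⟨by simp [hwR], by simpa using ⟨hcon.1, hdR⟩⟩
    simp at this
    omega
  have hnbr₀ := hnbr Q hne hQ hwQ hd rfl
  have hnbr₁ := hnbr _ hne' hQ.reverse (by simpa using hwQ) hdr (by simp)
  have hs₀ := minDegree_lt_card_attachments_add hQ.2 (List.head_mem hne) hnbr₀
  have hs₁ := minDegree_lt_card_attachments_add hQ.reverse.2 (List.head_mem hne') hnbr₁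
  simp only [List.head_reverse, List.length_reverse] at hs₁
  have hQL : ∀ L, G.IsPathList L → Q ⊆ L → L.length + 1 ≤ P.length :=
    fun L hL hQL => hw L hL (hQL hwQ)
  have hQrL : ∀ L, G.IsPathList L → Q.reverse ⊆ L → L.length + 1 ≤ P.length :=
    fun L hL hQL => hw L hL (hQL (by simpa using hwQ))
  set u₀ := Q.head hne with hu₀
  set u₁ := Q.getLast hne with hu₁
  set N₀ := G.attachments P u₀ with hN₀
  set N₁ := G.attachments P u₁ with hN₁
  have hend : ∀ i ∈ N₀ ∪ N₁, Q.length + 1 ≤ i ∧ i + 1 + Q.length + 1 ≤ P.length := by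
    intro i hi
    rcases Finset.mem_union.1 hi with hi | hi
    · obtain ⟨hi', hi⟩ := mem_attachments.1 hi
      exact length_bounds_of_attached hP hQ hd hi'
        (by simpa [List.head?_eq_some_head hne] using hi) hQL
    · obtain ⟨hi', hi⟩ := mem_attachments.1 hi
      simpa using length_bounds_of_attached hP hQ.reverse hdr hi'
        (by simpa [List.getLast?_eq_getLast_of_ne_nil hne] using hi) hQrL
  have hgap : ∀ u ∈ Q, ∀ i ∈ G.attachments P u, ∀ j ∈ G.attachments P u, i < j → i + 2 ≤ j := by
    intro u hu i hi j hj hij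
    exact gap_of_attached (R := [u]) (e := 0) hP (.singleton u)
      (by simpa using fun h => hd h hu) (by simp) hij hi hj (fun L hL _ => hmax L hL)
  have hgap₀ := hgap u₀ (List.head_mem hne)
  have hgap₁ := hgap u₁ (List.getLast_mem hne)
  have hbig : ∀ i ∈ N₀, ∀ j ∈ N₁, i < j → i + 1 + Q.length + 1 ≤ j :=
    fun i hi j hj hij => gap_of_attached hP hQ hd hne hij hi hj hQL
  have hbig' : ∀ i ∈ N₁, ∀ j ∈ N₀, i < j → i + 1 + Q.length + 1 ≤ j := by
    intro i hi j hj hij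
    simpa using gap_of_attached (R := Q.reverse) hP hQ.reverse hdr hne' hij
      (by simpa using hi) (by simpa using hj) hQrL
  have hgapU : ∀ i ∈ N₀ ∪ N₁, ∀ j ∈ N₀ ∪ N₁, i < j → i + 2 ≤ j := by
    intro i hi j hj hij
    rcases Finset.mem_union.1 hi with hi | hi <;> rcases Finset.mem_union.1 hj with hj | hj
    · exact hgap₀ i hi j hj hij
    · have := hbig i hi j hj hij; omega
    · have := hbig' i hi j hj hij; omega
    · exact hgap₁ i hi j hj hij
  -- If there are no attachments, all neighbours of `u₀` lie on `Q`, one of them at index at least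
  -- δ; it closes a cycle on at least δ + 1 vertices.
  rcases (N₀ ∪ N₁).eq_empty_or_nonempty with hN | ⟨i₀, hi₀⟩
  · have hN₀e : N₀ = ∅ := (Finset.union_eq_empty.1 hN).1
    rw [hN₀e, Finset.card_empty] at hs₀
    have hall : ∀ y, G.Adj u₀ y → y ∈ Q := by
      intro y hy
      refine (hnbr₀ y hy).resolve_left fun hyP => ?_
      obtain ⟨i, hi, rfl⟩ := List.getElem_of_mem hyP
      have : i ∈ N₀ := mem_attachments.2 ⟨hi, hy.symm⟩
      simp [hN₀e] at this
    have hδ1 : 1 ≤ δ := by omega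
    have hu₀t : u₀ ∈ Q.take δ := by
      have : (Q.take δ).head? = some u₀ := by
        rw [List.head?_take, if_neg (by omega), List.head?_eq_some_head hne]
      exact List.mem_of_mem_head? this
    obtain ⟨y, hy, hyd⟩ : ∃ y, G.Adj u₀ y ∧ y ∈ Q.drop δ := by
      by_contra! hcon
      have hsub : G.neighborFinset u₀ ⊆ (Q.take δ).toFinset.erase u₀ := by
        intro y hy
        rw [mem_neighborFinset] at hy
        have h1 := hall y hy
        rw [← List.take_append_drop δ Q, List.mem_append] at h1
        simpa [hy.ne'] using h1.resolve_right (hcon y hy)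
      have h1 := Finset.card_le_card hsub
      rw [Finset.card_erase_of_mem (by simpa using hu₀t), card_neighborFinset_eq_degree] at h1
      have h2 := (Q.take δ).toFinset_card_le
      have h3 := G.minDegree_le_degree u₀
      rw [List.length_take] at h2
      omega
    obtain ⟨A, B, hAB⟩ := List.append_of_mem hyd
    have hQeq : Q = (Q.take δ ++ A ++ [y]) ++ B := by
      conv_lhs => rw [← List.take_append_drop δ Q, hAB]
      simp
    have hCQ : Q.take δ ++ A ++ [y] <+: Q := ⟨B, hQeq.symm⟩
    have hhead : (Q.take δ ++ A ++ [y]).head (by simp) = u₀ := by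
      have : (Q.take δ ++ A ++ [y]).head? = some u₀ := by
        rw [List.append_assoc, List.head?_append_of_ne_nil _ (List.ne_nil_of_mem hu₀t),
          List.head?_take, if_neg (by omega), List.head?_eq_some_head hne]
      simpa [List.head?_eq_some_head] using this
    obtain ⟨R, hR, hRne, hdR, hlen, i, hi, hadj⟩ :=
      exists_isPathList_attached_of_cycle hG (P := P) (C := Q.take δ ++ A ++ [y])
        (List.ne_nil_of_length_pos (by omega)) (hQ.of_isInfix hCQ.isInfix) (by simp)
        (fun x hx hx' => hd hx (hCQ.subset hx'))
        (by rw [hhead]; simpa using hy.symm)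
    have := length_bounds_of_attached (e := 0) hP hR hdR hi hadj (fun L hL _ => hmax L hL)
    simp only [List.length_append, List.length_take, List.length_singleton] at hlen
    -- Here p ≥ 2(δ + 1) + 1 and t ≥ δ + 1, so the order is at least 3δ + 4.
    omega
  · have h₀ := hend i₀ hi₀
    -- From p ≥ 2t + 3 and p + t ≤ 3δ + 2.
    have htδ : Q.length < δ := by omega
    have hcardU := Finset.card_union_add_card_inter N₀ N₁
    rcases Nat.eq_zero_or_pos (N₀ ∩ N₁).card with hc | hc
    -- With no common attachment, gaps of 2 suffice: the union has at least 2(δ + 1 - t) positions.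
    · have := Finset.add_sum_le_of_separated (N₀ ∪ N₁) (fun _ => 2) (m := Q.length + 1)
        (p := P.length - Q.length) (by omega) (fun i hi => (hend i hi).1)
        (fun i hi => by have := hend i hi; omega) hgapU
      simp only [Finset.sum_const, smul_eq_mul] at this
      omega
    -- A common attachment is followed by a gap of t + 2, whichever end of `Q` the next one belongs
    -- to. The extra t pays for its being counted only once in the union.
    · have := Finset.add_sum_le_of_separated (N₀ ∪ N₁)
        (fun i => 2 + if i ∈ N₀ ∩ N₁ then Q.length else 0) (m := Q.length + 1)
        (p := P.length) (by omega) (fun i hi => (hend i hi).1)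
        (fun i hi => by have := hend i hi; split_ifs <;> omega) (by
          intro i hi j hj hij
          have h1 := hgapU i hi j hj hij
          split_ifs with hI
          · rw [Finset.mem_inter] at hI
            rcases Finset.mem_union.1 hj with hj | hj
            · have := hbig' i hI.2 j hj hij; omega
            · have := hbig i hI.1 j hj hij; omega
          · omega)
      rw [Finset.sum_add_distrib, ← Finset.sum_filter, Finset.filter_mem_eq_inter,
        Finset.inter_eq_right.2 (Finset.inter_subset_union)] at this
      simp only [Finset.sum_const, smul_eq_mul] at this
      rcases Nat.lt_or_ge 1 Q.length with ht2 | ht1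
      · have := mul_add_le_of_one_le hc ht2
        omega
      -- For t = 1 the ends coincide: at least δ positions, each of weight 3, force p ≥ 3δ + 2.
      · have h01 : u₀ = u₁ := by
          obtain ⟨a, ha⟩ := List.length_eq_one_iff.1 (le_antisymm ht1 ht)
          simp [hu₀, hu₁, ha]
        have hNN : N₀ = N₁ := by rw [hN₀, hN₁, h01]
        rw [← hNN, Finset.union_self, Finset.inter_self] at this
        rw [le_antisymm ht1 ht] at this hcard hs₀
        omega

theorem Connected.isDetourCovered [Fintype V] [DecidableRel G.Adj] (hG : G.Connected)
    (hδ : Fintype.card V ≤ 3 * G.minDegree + 2) : G.IsDetourCovered := by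
  intro w
  by_contra! hcon
  obtain ⟨P, ⟨hP, -⟩, hmax⟩ := exists_longest_isPathList (G := G) (fun _ => True)
    ⟨[w], .singleton w, trivial⟩
  refine not_isPathList_max_of_uncovered hG hδ (w := w) hP (fun L hL => hmax L hL trivial) ?_
  intro L hL hwL
  by_contra! hlen
  obtain ⟨u, v, p, hp, rfl⟩ := hL.exists_walk (List.ne_nil_of_mem hwL)
  refine hcon u v p ⟨hp, fun x y q hq => ?_⟩ hwL
  have := hmax _ (IsPathList.of_isPath hq) trivial
  rw [Walk.length_support] at this hlen
  omega

end SimpleGraph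

/-! ### The extremal graph -/

namespace SimpleGraph

/-- The block of a vertex: `[0, d]`, `[d + 1, 2 d + 1]` or the rest. -/
def cliqueBlock (d k : ℕ) : ℕ := if k ≤ d then 0 else if k ≤ 2 * d + 1 then 1 else 2

/-- Three cliques of orders `d`, `d + 1`, `n - 2 d - 2`, joined to the additional vertex `0`. -/
def threeCliques (n d : ℕ) : SimpleGraph (Fin n) where
  Adj a b := a ≠ b ∧ (a.val = 0 ∨ b.val = 0 ∨ cliqueBlock d a = cliqueBlock d b)
  symm := ⟨fun _ _ h => ⟨h.1.symm, by tauto⟩⟩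
  loopless := ⟨fun _ h => h.1 rfl⟩

instance (n d : ℕ) : DecidableRel (threeCliques n d).Adj :=
  fun a b => inferInstanceAs (Decidable (a ≠ b ∧ _))

theorem threeCliques_connected {n d : ℕ} (hn : 0 < n) : (threeCliques n d).Connected := by
  have h0 : ∀ v, (threeCliques n d).Reachable ⟨0, hn⟩ v := by
    intro v
    by_cases hv : (⟨0, hn⟩ : Fin n) = v
    · rw [hv]
    · exact Adj.reachable ⟨hv, Or.inl rfl⟩
  exact { preconnected := fun u v => (h0 u).symm.trans (h0 v), nonempty := ⟨⟨0, hn⟩⟩ }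

theorem card_filter_val_mem_Ico {n a b : ℕ} (hb : b ≤ n) :
    (Finset.univ.filter fun x : Fin n => a ≤ x.val ∧ x.val < b).card = b - a := by
  rw [← Nat.card_Ico, ← Finset.card_map Fin.valEmbedding]
  congr 1
  ext k
  simp only [Finset.mem_map, Finset.mem_filter, Finset.mem_univ, true_and, Finset.mem_Ico,
    Fin.valEmbedding_apply]
  exact ⟨by rintro ⟨x, hx, rfl⟩; exact hx, fun h => ⟨⟨k, by omega⟩, h, rfl⟩⟩

/-- The smallest clique reaches d + 1 because its block also contains the cut vertex 0. -/
theorem le_card_filter_cliqueBlock {n d : ℕ} (hn : 3 * d + 3 ≤ n) (x : Fin n) :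
    d + 1 ≤ (Finset.univ.filter fun y : Fin n => cliqueBlock d y = cliqueBlock d x).card := by
  have key : ∀ a b, b ≤ n → d + 1 ≤ b - a →
      (∀ y, a ≤ y → y < b → cliqueBlock d y = cliqueBlock d x) →
      d + 1 ≤ (Finset.univ.filter fun y : Fin n => cliqueBlock d y = cliqueBlock d x).card := by
    intro a b hb hab h
    rw [← card_filter_val_mem_Ico hb] at hab
    exact hab.trans (Finset.card_le_card
      (Finset.monotone_filter_right _ fun y _ hy => h y hy.1 hy.2))
  by_cases h1 : x.val ≤ d
  · exact key 0 (d + 1) (by omega) (by omega)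
      (fun y _ _ => by unfold cliqueBlock; split_ifs <;> omega)
  by_cases h2 : x.val ≤ 2 * d + 1
  · exact key (d + 1) (2 * d + 2) (by omega) (by omega)
      (fun y _ _ => by unfold cliqueBlock; split_ifs <;> omega)
  · exact key (2 * d + 2) n (by omega) (by omega)
      (fun y _ _ => by unfold cliqueBlock; split_ifs <;> omega)

theorem threeCliques_minDegree {n d : ℕ} (hd : 1 ≤ d) (hn : 3 * d + 3 ≤ n) :
    (threeCliques n d).minDegree = d := by
  have : Nonempty (Fin n) := ⟨⟨0, by omega⟩⟩
  refine le_antisymm ?_ ?_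
  · refine (minDegree_le_degree _ ⟨1, by omega⟩).trans ?_
    rw [← card_neighborFinset_eq_degree]
    have hsub : (threeCliques n d).neighborFinset ⟨1, by omega⟩ ⊆
        (Finset.univ.filter fun x : Fin n => 0 ≤ x.val ∧ x.val < d + 1).erase ⟨1, by omega⟩ := by
      intro y hy
      rw [mem_neighborFinset] at hy
      obtain ⟨h1, h2⟩ := hy
      refine Finset.mem_erase.2 ⟨h1.symm, Finset.mem_filter.2 ⟨Finset.mem_univ _, Nat.zero_le _, ?_⟩⟩
      by_contra hy
      have hy0 : y.val ≠ 0 := by omega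
      have hyd : ¬ y.val ≤ d := by omega
      simp only [cliqueBlock, if_pos hd, if_neg hyd, hy0, one_ne_zero, false_or] at h2
      split_ifs at h2
    refine (Finset.card_le_card hsub).trans ?_
    rw [Finset.card_erase_of_mem (by simp; omega), card_filter_val_mem_Ico (by omega)]
    omega
  · refine le_minDegree_of_forall_le_degree _ _ fun x => ?_
    have h1 := le_card_filter_cliqueBlock hn x
    rw [← card_neighborFinset_eq_degree]
    have hsub : (Finset.univ.filter fun y : Fin n => cliqueBlock d y = cliqueBlock d x).erase x ⊆
        (threeCliques n d).neighborFinset x := by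
      intro y hy
      rw [mem_neighborFinset]
      rw [Finset.mem_erase, Finset.mem_filter] at hy
      exact ⟨hy.1.symm, Or.inr (Or.inr hy.2.2.symm)⟩
    have h2 := Finset.card_le_card hsub
    rw [Finset.card_erase_of_mem (by simp)] at h2
    omega

theorem threeCliques_block_eq {n d : ℕ} : ∀ {l : List (Fin n)}, l.IsChain (threeCliques n d).Adj →
    (∀ x ∈ l, x.val ≠ 0) → ∀ x ∈ l, ∀ y ∈ l, cliqueBlock d x = cliqueBlock d y
  | [], _, _ => by simp
  | [a], _, _ => by simp
  | a :: b :: l, h, h0 => by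
    rw [List.isChain_cons_cons] at h
    have ih := threeCliques_block_eq h.2 fun x hx => h0 x (List.mem_cons_of_mem _ hx)
    have ha : a.val ≠ 0 := h0 a (by simp)
    have hb : b.val ≠ 0 := h0 b (by simp)
    have hab : cliqueBlock d a = cliqueBlock d b := by
      have := h.1.2
      tauto
    have key : ∀ x ∈ a :: b :: l, cliqueBlock d x = cliqueBlock d b := by
      intro x hx
      rcases List.mem_cons.1 hx with rfl | hx
      · exact hab
      · exact ih x hx b (by simp)
    exact fun x hx y hy => (key x hx).trans (key y hy).symm

/-- A path cannot meet all three cliques. -/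
theorem threeCliques_not_meets_all {n d : ℕ} {l : List (Fin n)}
    (h : (threeCliques n d).IsPathList l) {a b c : Fin n} (ha : a ∈ l) (hb : b ∈ l) (hc : c ∈ l)
    (ha0 : a.val ≠ 0) (had : cliqueBlock d a = 0) (hbd : cliqueBlock d b = 1)
    (hcd : cliqueBlock d c = 2) : False := by
  have hb0 : b.val ≠ 0 := fun h => by simp [cliqueBlock, h] at hbd
  have hc0 : c.val ≠ 0 := fun h => by simp [cliqueBlock, h] at hcd
  by_cases h0 : ∃ x ∈ l, x.val = 0
  · obtain ⟨z, hz, hz0⟩ := h0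
    obtain ⟨l₁, l₂, rfl⟩ := List.append_of_mem hz
    have hnd := h.2
    rw [List.nodup_append] at hnd
    have e₁ := threeCliques_block_eq h.1.left_of_append fun x hx hx0 =>
      hnd.2.2 x hx z (by simp) (Fin.ext (hx0.trans hz0.symm))
    have e₂ := threeCliques_block_eq h.1.right_of_append.tail fun x hx hx0 =>
      (List.nodup_cons.1 hnd.2.1).1 ((Fin.ext (hx0.trans hz0.symm) : x = z) ▸ hx)
    have split : ∀ x ∈ l₁ ++ z :: l₂, x.val ≠ 0 → x ∈ l₁ ∨ x ∈ l₂ := by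
      intro x hx hx0
      have : x ≠ z := fun h => hx0 (h ▸ hz0)
      simpa [this] using hx
    rcases split a ha ha0 with ha | ha <;> rcases split b hb hb0 with hb | hb <;>
      rcases split c hc hc0 with hc | hc
    · have := e₁ a ha b hb; omega
    · have := e₁ a ha b hb; omega
    · have := e₁ a ha c hc; omega
    · have := e₂ b hb c hc; omega
    · have := e₁ b hb c hc; omega
    · have := e₂ a ha c hc; omega
    · have := e₂ a ha b hb; omega
    · have := e₂ a ha b hb; omega
  · push Not at h0
    have := threeCliques_block_eq h.1 h0 a ha b hb
    omega

/-- A path meeting the smallest clique misses one of the other two entirely, and with it at least d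
+ 1 vertices. -/
theorem threeCliques_length_le {n d : ℕ} (hn : 3 * d + 3 ≤ n) {l : List (Fin n)}
    (h : (threeCliques n d).IsPathList l) {a : Fin n} (ha : a ∈ l)
    (ha0 : a.val ≠ 0) (had : cliqueBlock d a = 0) : l.length + (d + 1) ≤ n := by
  have key : ∀ b : Fin n, (∀ y ∈ l, cliqueBlock d y ≠ cliqueBlock d b) →
      l.length + (d + 1) ≤ n := by
    intro b hb
    have h1 := le_card_filter_cliqueBlock hn b
    have h2 : Disjoint l.toFinset
        (Finset.univ.filter fun y : Fin n => cliqueBlock d y = cliqueBlock d b) :=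
      Finset.disjoint_left.2 fun y hy hy' => hb y (by simpa using hy) (by simpa using hy')
    have h3 := Finset.card_le_univ (l.toFinset ∪
      (Finset.univ.filter fun y : Fin n => cliqueBlock d y = cliqueBlock d b))
    rw [Finset.card_union_of_disjoint h2, List.toFinset_card_of_nodup h.2, Fintype.card_fin] at h3
    omega
  have hB : cliqueBlock d (d + 1) = 1 := by simp [cliqueBlock]; omega
  have hC : cliqueBlock d (2 * d + 2) = 2 := by simp [cliqueBlock]; omega
  by_contra hcon
  have hb : ∃ b ∈ l, cliqueBlock d b = 1 := by
    by_contra! hb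
    exact hcon (key ⟨d + 1, by omega⟩ (by simpa [hB] using hb))
  have hc : ∃ c ∈ l, cliqueBlock d c = 2 := by
    by_contra! hc
    exact hcon (key ⟨2 * d + 2, by omega⟩ (by simpa [hC] using hc))
  obtain ⟨b, hb, hbd⟩ := hb
  obtain ⟨c, hc, hcd⟩ := hc
  exact threeCliques_not_meets_all h ha hb hc ha0 had hbd hcd

theorem threeCliques_exists_isPathList {n d : ℕ} (hn : 3 * d + 3 ≤ n) :
    ∃ l, (threeCliques n d).IsPathList l ∧ l.length = n - d := by
  -- All of the second clique, then the cut vertex, then all of the third clique.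
  let f : Fin (n - d) → Fin n := fun k =>
    ⟨if k.val < d + 1 then d + 1 + k else if k.val = d + 1 then 0 else d + k,
      by have := k.2; split_ifs <;> omega⟩
  refine ⟨List.ofFn f, ⟨?_, List.nodup_ofFn.2 fun i j hij => ?_⟩, List.length_ofFn⟩
  · rw [List.isChain_ofFn]
    intro i hi
    refine ⟨fun h => ?_, ?_⟩
    · have := congrArg Fin.val h
      simp only [f] at this
      split_ifs at this <;> omega
    · simp only [f, cliqueBlock]
      split_ifs <;> omega
  · have := congrArg Fin.val hij
    simp only [f] at this
    ext
    split_ifs at this <;> omega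

theorem threeCliques_not_isDetourCovered {n d : ℕ} (hd : 1 ≤ d) (hn : 3 * d + 3 ≤ n) :
    ¬ (threeCliques n d).IsDetourCovered := by
  intro hcov
  obtain ⟨u, v, p, ⟨hp, hmax⟩, hw⟩ := hcov ⟨1, by omega⟩
  have h1 := threeCliques_length_le hn (IsPathList.of_isPath hp) hw (by simp)
    (by simp [cliqueBlock]; omega)
  obtain ⟨l, hl, hlen⟩ := threeCliques_exists_isPathList hn
  obtain ⟨x, y, q, hq, rfl⟩ := hl.exists_walk (List.ne_nil_of_length_pos (by omega))
  have h2 := hmax x y q hq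
  rw [Walk.length_support] at h1 hlen
  omega

end SimpleGraph

theorem theorem5 :
    -- every connected graph of order n with minimum degree at least (n - 2) / 3 is detour covered
    (∀ (V : Type*) [Fintype V] (G : SimpleGraph V) [DecidableRel G.Adj],
      G.Connected → ((Fintype.card V : ℚ) - 2) / 3 ≤ (G.minDegree : ℚ) →
        G.IsDetourCovered) ∧
    -- the bound is best possible, for every order n ≥ 6
    (∀ n : ℕ, 6 ≤ n →
      ∃ (G : SimpleGraph (Fin n)) (_ : DecidableRel G.Adj),
        G.Connected ∧ (G.minDegree : ℤ) = ⌈((n : ℚ) - 2) / 3⌉ - 1 ∧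
          ¬ G.IsDetourCovered) := by
  refine ⟨fun V _ G _ hG hδ => hG.isDetourCovered ?_, fun n hn => ?_⟩
  · have : (Fintype.card V : ℚ) ≤ 3 * G.minDegree + 2 := by linarith
    exact_mod_cast this
  · obtain ⟨d, h1, h2, h3⟩ : ∃ d, 1 ≤ d ∧ 3 * d + 3 ≤ n ∧ n ≤ 3 * d + 5 :=
      ⟨(n - 3) / 3, by omega, by omega, by omega⟩
    refine ⟨SimpleGraph.threeCliques n d, inferInstance,
      SimpleGraph.threeCliques_connected (by omega), ?_,
      SimpleGraph.threeCliques_not_isDetourCovered h1 h2⟩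
    rw [SimpleGraph.threeCliques_minDegree h1 h2, eq_sub_iff_add_eq, eq_comm, Int.ceil_eq_iff]
    have h2' : (3 * d + 3 : ℚ) ≤ n := by exact_mod_cast h2
    have h3' : (n : ℚ) ≤ 3 * d + 5 := by exact_mod_cast h3
    push_cast
    constructor <;> linarith
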